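/- Let $K,\kappa,i$ be integers and $\epsilon\in\{0,1\}$ with $K=2\kappa-\epsilon$ and $1\le i\le\kappa$. Write $(q)_m=\prod_{n=1}^{m}(1-q^n)$. For non-negative integers $m_1,\dots,m_{K-1}$ put $$\tilde N_j=m_j+m_{j+1}+\cdots+m_{K-1},\qquad \tilde N=m_1+2m_2+\cdots+(K-1)m_{K-1},$$ $$\tilde M=m_1+m_3+m_5+\cdots+m_{K-1-\epsilon}\quad(\text{the sum of all } m_j \text{ with } j \text{ odd},\ j\le K-1),$$ $$\tilde L_{2i}=m_{2i}+m_{2i+1}+2(m_{2i+2}+m_{2i+3})+3(m_{2i+4}+m_{2i+5})+\cdots$$ (with $m_j=0$ for $j\ge K$), and let $$G_{K,i}(z;q)=\sum_{m_1,\dots,m_{K-1}=0}^{\infty}\frac{q^{\frac12(\tilde N_1^2+\cdots+\tilde N_{K-1}^2+\tilde M)+\tilde L_{2i}}\,z^{\tilde N}}{(q)_{m_1}(q)_{m_2}\cdots(q)_{m_{K-1}}}.$$ Then, as formal power series in $q$ with integer coefficients (the multiple sum at $z=1$ and the infinite products below converge coefficientwise), if $2i<K+1$, $$G_{K,i}(1;q)=\prod_{n=1}^{\infty}(1+q^n)\prod_{\substack{n\ge1\\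 n\not\equiv 0,\pm i\ (\mathrm{mod}\ K+1)}}\frac{1}{1-q^n},$$ and if $\epsilon=1$ and $i=\kappa$, $$G_{K,i}(1;q)=\prod_{\substack{n\ge1\\ n\not\equiv 0\ (\mathrm{mod}\ \kappa)}}\frac{1+q^n}{1-q^n}.$$ -/

import Mathlib

open scoped PowerSeries PowerSeries.WithPiTopology

namespace JaggedPaths

/-- The formal variable `q`. All series live in `ℤ⟦X⟧` with the topology of coefficientwise
convergence (`ℤ` being discrete). -/
noncomputable abbrev q : ℤ⟦X⟧ := PowerSeries.X

/-- `(a)_n = (a; q)_n = ∏_{i = 0}^{n - 1} (1 - a q^i)`. -/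
noncomputable def qPochhammer (a : ℤ⟦X⟧) (n : ℕ) : ℤ⟦X⟧ :=
  ∏ i ∈ Finset.range n, (1 - a * q ^ i)

/-- `1 / f` for a power series `f` with constant coefficient `1`. -/
noncomputable def recip (f : ℤ⟦X⟧) : ℤ⟦X⟧ := PowerSeries.invOfUnit f 1

theorem mul_recip (f : ℤ⟦X⟧) (hf : PowerSeries.constantCoeff f = 1) : f * recip f = 1 :=
  PowerSeries.mul_invOfUnit f 1 (by simpa using hf)

theorem constantCoeff_qPochhammer (n : ℕ) :
    PowerSeries.constantCoeff (qPochhammer q n) = 1 := by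
  simp [qPochhammer, map_prod]

theorem constantCoeff_one_sub_q_pow (n : ℕ) (hn : n ≠ 0) :
    PowerSeries.constantCoeff (1 - q ^ n) = 1 := by
  simp [hn]

/- The summation variables `m_1, …, m_{K-1}` are the values of `m : Fin (K - 1) → ℕ`:
the entry `m l` is `m_{l+1}`. -/

/-- `Ñ_j = m_j + m_{j+1} + ⋯ + m_{K-1}`. -/
def tildeN {K : ℕ} (m : Fin (K - 1) → ℕ) (j : ℕ) : ℕ :=
  ∑ l : Fin (K - 1), if j ≤ (l : ℕ) + 1 then m l else 0

/-- `M̃ = m_1 + m_3 + m_5 + ⋯`, the sum of all `m_j` with `j` odd, `j ≤ K - 1`. -/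
def tildeM {K : ℕ} (m : Fin (K - 1) → ℕ) : ℕ :=
  ∑ l : Fin (K - 1), if Odd ((l : ℕ) + 1) then m l else 0

/-- `L̃_a = m_a + m_{a+1} + 2 (m_{a+2} + m_{a+3}) + 3 (m_{a+4} + m_{a+5}) + ⋯`. -/
def tildeL {K : ℕ} (m : Fin (K - 1) → ℕ) (a : ℕ) : ℕ :=
  ∑ l : Fin (K - 1), if a ≤ (l : ℕ) + 1 then (((l : ℕ) + 1 - a) / 2 + 1) * m l else 0

/-- `Ñ = m_1 + 2 m_2 + ⋯ + (K - 1) m_{K-1}`. -/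
def tildeNTotal {K : ℕ} (m : Fin (K - 1) → ℕ) : ℕ :=
  ∑ l : Fin (K - 1), ((l : ℕ) + 1) * m l

/-- `Ñ_1² + Ñ_2² + ⋯ + Ñ_{K-1}² + M̃`, which is always even (see `two_dvd_doubleExponent`). -/
def doubleExponent {K : ℕ} (m : Fin (K - 1) → ℕ) : ℕ :=
  (∑ j ∈ Finset.Icc 1 (K - 1), tildeN m j ^ 2) + tildeM m

theorem sum_tildeN {K : ℕ} (m : Fin (K - 1) → ℕ) :
    ∑ j ∈ Finset.Icc 1 (K - 1), tildeN m j = tildeNTotal m := by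
  unfold tildeN tildeNTotal
  rw [Finset.sum_comm]
  refine Finset.sum_congr rfl fun l _ => ?_
  rw [← Finset.sum_filter, Finset.sum_const, smul_eq_mul]
  congr 1
  have : (Finset.Icc 1 (K - 1)).filter (fun j => j ≤ (l : ℕ) + 1) = Finset.Icc 1 ((l : ℕ) + 1) := by
    ext j
    have := l.isLt
    simp only [Finset.mem_filter, Finset.mem_Icc]
    omega
  rw [this, Nat.card_Icc]
  omega

theorem two_dvd_doubleExponent {K : ℕ} (m : Fin (K - 1) → ℕ) : 2 ∣ doubleExponent m := by
  rw [← ZMod.natCast_eq_zero_iff]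
  have hsq : ∀ x : ZMod 2, x ^ 2 = x := by decide
  have h1 : ((∑ j ∈ Finset.Icc 1 (K - 1), tildeN m j ^ 2 : ℕ) : ZMod 2)
      = ((tildeNTotal m : ℕ) : ZMod 2) := by
    rw [← sum_tildeN]
    push_cast
    exact Finset.sum_congr rfl fun j _ => hsq _
  unfold doubleExponent
  rw [Nat.cast_add, h1, ← Nat.cast_add, ZMod.natCast_eq_zero_iff]
  unfold tildeNTotal tildeM
  rw [← Finset.sum_add_distrib]
  refine Finset.dvd_sum fun l _ => ?_
  split_ifs with h
  · obtain ⟨c, hc⟩ := h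
    exact ⟨(c + 1) * m l, by rw [hc]; ring⟩
  · rw [Nat.not_odd_iff_even] at h
    obtain ⟨c, hc⟩ := h
    exact ⟨c * m l, by rw [hc]; ring⟩

/-- The exponent of `q`: `½ (Ñ_1² + ⋯ + Ñ_{K-1}² + M̃) + L̃_{2i}`. -/
def qExponent {K : ℕ} (i : ℕ) (m : Fin (K - 1) → ℕ) : ℕ :=
  doubleExponent m / 2 + tildeL m (2 * i)

/-- The summand of `G_{K,i}(z; q)`:
`q^{½ (Ñ_1² + ⋯ + Ñ_{K-1}² + M̃) + L̃_{2i}} z^Ñ / ((q)_{m_1} ⋯ (q)_{m_{K-1}})`. -/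
noncomputable def summandG (K i : ℕ) (z : ℤ⟦X⟧) (m : Fin (K - 1) → ℕ) : ℤ⟦X⟧ :=
  q ^ qExponent i m * z ^ tildeNTotal m * recip (∏ l : Fin (K - 1), qPochhammer q (m l))

/-- The multiple sum `G_{K,i}(z; q)`, over all `m_1, …, m_{K-1} ≥ 0`. -/
noncomputable def G (K i : ℕ) (z : ℤ⟦X⟧) : ℤ⟦X⟧ :=
  ∑' m : Fin (K - 1) → ℕ, summandG K i z m

/- In the infinite products, which run over the integers `n ≥ 1`, the index is `n - 1 : ℕ`,
and excluded values of `n` contribute the factor `1`. -/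

/-- The `n`-th factor of `∏_{n ≥ 1, n ≢ 0, ± i mod K + 1} 1 / (1 - q^n)`. -/
noncomputable def factorRR (K i n : ℕ) : ℤ⟦X⟧ :=
  if ¬ (n : ℤ) ≡ 0 [ZMOD (K : ℤ) + 1] ∧ ¬ (n : ℤ) ≡ (i : ℤ) [ZMOD (K : ℤ) + 1] ∧
      ¬ (n : ℤ) ≡ -(i : ℤ) [ZMOD (K : ℤ) + 1] then
    recip (1 - q ^ n)
  else 1

/-- The `n`-th factor of `∏_{n ≥ 1, n ≢ 0 mod κ} (1 + q^n) / (1 - q^n)`. -/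
noncomputable def factorOver (κ n : ℕ) : ℤ⟦X⟧ :=
  if ¬ (n : ℤ) ≡ 0 [ZMOD (κ : ℤ)] then (1 + q ^ n) * recip (1 - q ^ n) else 1

end JaggedPaths

/-!
The exponent of `q` in the summand is `∑_j binom(Ñ_j + δ_j, 2)`, where `δ_j = 0` for the even
`j < 2 i` and `δ_j = 1` for all other `j` (`qExponent_eq_shiftedExponent`). Truncating the sum to
`Ñ_1 ≤ n` and inserting the factor `1 / (q)_{n - Ñ_1}` gives a nested sum over
`n ≥ Ñ_1 ≥ ⋯ ≥ Ñ_{K-1}` (`chainSum`), from which `G` is recovered by multiplying with `(q)_n` and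
letting `n → ∞`. Each of the nested summations is
`F ↦ (n ↦ ∑_s q^{binom(s + d, 2)} F(s) / (q)_{n-s})` with `d ∈ {0, 1}`.

This is a Bailey chain made of half steps. If `F` is expanded as
`F(n) = ∑_r α_r (-q^{r+e})_{n-r} / ((q)_{n-r} (q)_{n+r+c})` with `d + e = c + 1`, then the summation
replaces `e` by `d` and `α_r` by `α_r q^{binom(r + d, 2)}` (`sum_mul_baileySum`); this is the
`q`-Chu–Vandermonde sum. With `c = 1` one can repeat steps `d = 1`; with `c = 0` the steps `d = 0`
and `d = 1` alternate. The innermost `K - 2 i + 2` summations, counting one that produces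
`1 / (q)_n` from the unit Bailey pair, are done with `c = 1`; then the base is changed to `c = 0`
(`baileySum_change_base`), and the remaining `2 i - 2` summations are done there. The outcome
(`chainSum_shift`) is `(-q)_n ∑_r θ_r / ((q)_{n-r} (q)_{n+r})`, where the `θ_r` are the terms of the
theta series `∑_{r ∈ ℤ} (-1)^r q^{(K+1) r (r + 1) / 2 - i r}`.

As `n → ∞`, Jacobi's triple product (`tendsto_sum_thetaCoeff`) gives
`(q)_∞ G = (-q)_∞ (q^{K+1}, q^i, q^{K+1-i}; q^{K+1})_∞` (`tprod_mul_G`). When `2 i < K + 1` this is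
the first product formula. When `K + 1 = 2 i`, Euler's identity
`(x; x²)_∞ (-x; x)_∞ = 1` at `x = q^i` turns it into the second one.

Limits of power series are taken through divisibility of differences by powers of `q`.
-/

namespace JaggedPaths

open Finset

/-! ### Finite summation formulas -/

section Algebra

variable {R : Type*} [CommRing R]

/-- The shifted factorial `(b; p)_n` in an arbitrary commutative ring, with arbitrary base `p`. -/
def poch (p b : R) (n : ℕ) : R := ∏ j ∈ range n, (1 - b * p ^ j)

@[simp] theorem poch_zero (p b : R) : poch p b 0 = 1 := by simp [poch]

theorem poch_succ (p b : R) (n : ℕ) : poch p b (n + 1) = poch p b n * (1 - b * p ^ n) := by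
  simp [poch, prod_range_succ]

theorem poch_add (p b : R) (m n : ℕ) :
    poch p b (m + n) = poch p b m * poch p (b * p ^ m) n := by
  simp only [poch, prod_range_add]
  congr 1
  exact prod_congr rfl fun j _ => by ring

theorem poch_succ' (p b : R) (n : ℕ) : poch p b (n + 1) = (1 - b) * poch p (b * p) n := by
  have h := poch_add p b 1 n
  rw [add_comm 1 n] at h
  simpa [poch_succ] using h

variable {p : R} {w : ℕ → R}

theorem recip_poch_zero (hw : ∀ n, w n * poch p p n = 1) : w 0 = 1 := by simpa using hw 0

theorem one_sub_mul_recip_poch_succ (hw : ∀ n, w n * poch p p n = 1) (n : ℕ) :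
    (1 - p ^ (n + 1)) * w (n + 1) = w n := by
  have h1 := hw n
  have h2 := hw (n + 1)
  rw [poch_succ] at h2
  calc (1 - p ^ (n + 1)) * w (n + 1) = (w n * poch p p n) * ((1 - p ^ (n + 1)) * w (n + 1)) := by
        rw [h1, one_mul]
    _ = w n * (w (n + 1) * (poch p p n * (1 - p * p ^ n))) := by ring
    _ = w n := by rw [h2, mul_one]

theorem recip_poch_eq_recip_poch_add_mul (hw : ∀ n, w n * poch p p n = 1) (m k : ℕ) :
    w m = w (m + k) * poch p (p ^ (m + 1)) k := by
  induction k with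
  | zero => simp
  | succ k ih =>
    have := one_sub_mul_recip_poch_succ hw (m + k)
    rw [ih, poch_succ, ← this]
    ring_nf

theorem one_sub_pow_cancel (hw : ∀ n, w n * poch p p n = 1) (n : ℕ) {x y : R}
    (h : (1 - p ^ (n + 1)) * x = (1 - p ^ (n + 1)) * y) : x = y := by
  have h2 := hw (n + 1)
  rw [poch_succ] at h2
  calc x = (w (n + 1) * (poch p p n * (1 - p * p ^ n))) * x := by rw [h2, one_mul]
    _ = w (n + 1) * poch p p n * ((1 - p ^ (n + 1)) * x) := by ring
    _ = w (n + 1) * poch p p n * ((1 - p ^ (n + 1)) * y) := by rw [h]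
    _ = (w (n + 1) * (poch p p n * (1 - p * p ^ n))) * y := by ring
    _ = y := by rw [h2, one_mul]

/-- The `q`-Pascal rule, in the form it takes for sums against `1 / ((p)_t (p)_u)`,
`t + u = N + 1`. -/
theorem one_sub_mul_sum_antidiagonal_succ (hw : ∀ n, w n * poch p p n = 1) (N : ℕ)
    (f : ℕ → ℕ → R) :
    (1 - p ^ (N + 1)) * ∑ x ∈ antidiagonal (N + 1), w x.1 * w x.2 * f x.1 x.2 =
      ∑ x ∈ antidiagonal N, w x.1 * w x.2 * f x.1 (x.2 + 1) +
        ∑ x ∈ antidiagonal N, p ^ x.2 * (w x.1 * w x.2 * f (x.1 + 1) x.2) := by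
  have key : (1 - p ^ (N + 1)) * ∑ x ∈ antidiagonal (N + 1), w x.1 * w x.2 * f x.1 x.2 =
      ∑ x ∈ antidiagonal (N + 1), (1 - p ^ x.2) * (w x.1 * w x.2 * f x.1 x.2) +
      ∑ x ∈ antidiagonal (N + 1), p ^ x.2 * (1 - p ^ x.1) * (w x.1 * w x.2 * f x.1 x.2) := by
    rw [mul_sum, ← sum_add_distrib]
    refine sum_congr rfl fun x hx => ?_
    rw [← mem_antidiagonal.1 hx, pow_add]
    ring
  rw [key, Nat.sum_antidiagonal_succ', Nat.sum_antidiagonal_succ]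
  simp only [pow_zero, sub_self, zero_mul, mul_zero, zero_add]
  congr 1
  · refine sum_congr rfl fun x _ => ?_
    rw [← one_sub_mul_recip_poch_succ hw x.2]
    ring
  · refine sum_congr rfl fun x _ => ?_
    rw [← one_sub_mul_recip_poch_succ hw x.1]
    ring

/-- The `q`-Chu–Vandermonde sum, cleared of denominators in the parameters. -/
theorem sum_antidiagonal_chuVandermonde (hw : ∀ n, w n * poch p p n = 1) (N : ℕ) (a b : R) :
    ∑ x ∈ antidiagonal N, w x.1 * w x.2 *
      ((-b) ^ x.1 * p ^ (x.1.choose 2) * poch p a x.1 * poch p (a * b * p ^ x.1) x.2) =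
      w N * poch p b N := by
  induction N generalizing a with
  | zero => simp [recip_poch_zero hw]
  | succ N ih =>
    apply one_sub_pow_cancel hw N
    -- The two terms of the Pascal rule are the sums with parameters `a` and `a * p`.
    rw [one_sub_mul_sum_antidiagonal_succ hw N fun t u =>
      (-b) ^ t * p ^ (t.choose 2) * poch p a t * poch p (a * b * p ^ t) u]
    have h1 : ∑ x ∈ antidiagonal N, w x.1 * w x.2 * ((-b) ^ x.1 * p ^ (x.1.choose 2) *
        poch p a x.1 * poch p (a * b * p ^ x.1) (x.2 + 1)) =
        (1 - a * b * p ^ N) * (w N * poch p b N) := by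
      rw [← ih a, mul_sum]
      refine sum_congr rfl fun x hx => ?_
      rw [← mem_antidiagonal.1 hx, poch_succ, pow_add]
      ring
    have h2 : ∑ x ∈ antidiagonal N, p ^ x.2 * (w x.1 * w x.2 * ((-b) ^ (x.1 + 1) *
        p ^ ((x.1 + 1).choose 2) * poch p a (x.1 + 1) * poch p (a * b * p ^ (x.1 + 1)) x.2)) =
        -b * p ^ N * (1 - a) * (w N * poch p b N) := by
      rw [← ih (a * p), mul_sum]
      refine sum_congr rfl fun x hx => ?_
      have e : a * b * p ^ (x.1 + 1) = a * p * b * p ^ x.1 := by ring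
      rw [← mem_antidiagonal.1 hx, poch_succ', Nat.choose_succ_succ' x.1 1, Nat.choose_one_right, e]
      ring
    rw [h1, h2, poch_succ, ← one_sub_mul_recip_poch_succ hw N]
    ring

/-- The finite `q`-binomial theorem, in homogeneous form. -/
theorem sum_antidiagonal_qBinomial (hw : ∀ n, w n * poch p p n = 1) (N : ℕ) (b c : R) :
    ∑ x ∈ antidiagonal N, w x.1 * w x.2 * ((-b) ^ x.1 * c ^ x.2 * p ^ (x.1.choose 2)) =
      w N * ∏ j ∈ range N, (c - b * p ^ j) := by
  induction N with
  | zero => simp [recip_poch_zero hw]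
  | succ N ih =>
    apply one_sub_pow_cancel hw N
    rw [one_sub_mul_sum_antidiagonal_succ hw N fun t u => (-b) ^ t * c ^ u * p ^ (t.choose 2)]
    have h1 : ∑ x ∈ antidiagonal N, w x.1 * w x.2 * ((-b) ^ x.1 * c ^ (x.2 + 1) *
        p ^ (x.1.choose 2)) = c * (w N * ∏ j ∈ range N, (c - b * p ^ j)) := by
      rw [← ih, mul_sum]
      exact sum_congr rfl fun x hx => by ring
    have h2 : ∑ x ∈ antidiagonal N, p ^ x.2 * (w x.1 * w x.2 * ((-b) ^ (x.1 + 1) * c ^ x.2 *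
        p ^ ((x.1 + 1).choose 2))) = -b * p ^ N * (w N * ∏ j ∈ range N, (c - b * p ^ j)) := by
      rw [← ih, mul_sum]
      refine sum_congr rfl fun x hx => ?_
      rw [← mem_antidiagonal.1 hx, Nat.choose_succ_succ' x.1 1, Nat.choose_one_right]
      ring
    rw [h1, h2, prod_range_succ, ← one_sub_mul_recip_poch_succ hw N]
    ring

/-! ### The finite triple product -/

/-- The coefficients of the bilateral theta series `∑_{r ∈ ℤ} (-x)^r p^{r (r - 1) / 2}`, where
`x y = p`, the terms of indices `r` and `-r` being put together. -/
def thetaCoeff (p x y : R) (r : ℕ) : R :=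
  if r = 0 then 1 else (-x) ^ r * p ^ r.choose 2 + (-y) ^ r * p ^ r.choose 2

theorem two_mul_choose_two (r : ℕ) : 2 * (r.choose 2 : ℤ) = (r : ℤ) * (r - 1) := by
  induction r with
  | zero => simp
  | succ r ih =>
    rw [Nat.choose_succ_succ' r 1, Nat.choose_one_right]
    push_cast
    linarith

/-- The finite form of Jacobi's triple product identity. -/
theorem finite_jacobi [IsDomain R] (hw : ∀ n, w n * poch p p n = 1) {x y : R} (hxy : x * y = p)
    (hp : p ≠ 0) (n : ℕ) :
    ∑ r ∈ range (n + 1), thetaCoeff p x y r * (w (n - r) * w (n + r)) =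
      w (2 * n) * (poch p x n * poch p y n) := by
  have hx : x ≠ 0 := fun h => hp (by rw [← hxy, h, zero_mul])
  -- The `q`-binomial theorem with `b = x`, `c = p ^ n` is the claim multiplied by this monomial.
  have hA : (-x) ^ n * p ^ (n.choose 2 + n * n) ≠ 0 :=
    mul_ne_zero (pow_ne_zero _ (neg_ne_zero.2 hx)) (pow_ne_zero _ hp)
  have hprod : ∏ j ∈ range (n + n), (p ^ n - x * p ^ j) =
      (-x) ^ n * p ^ (n.choose 2 + n * n) * (poch p x n * poch p y n) := by
    have h1 : ∏ j ∈ range n, (p ^ n - x * p ^ j) = (-x) ^ n * p ^ (n.choose 2) * poch p y n := by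
      have hc : n.choose 2 = ∑ j ∈ range n, j := by
        rw [Finset.sum_range_id, Nat.choose_two_right]
      rw [poch, ← prod_range_reflect (fun j => 1 - y * p ^ j), hc, ← prod_pow_eq_pow_sum]
      rw [show (-x) ^ n = ∏ _j ∈ range n, (-x) by simp, ← prod_mul_distrib, ← prod_mul_distrib]
      refine prod_congr rfl fun j hj => ?_
      have hj' := mem_range.1 hj
      obtain ⟨k, rfl⟩ : ∃ k, n = j + (k + 1) := ⟨n - j - 1, by omega⟩
      have e : j + (k + 1) - 1 - j = k := by omega
      rw [e, pow_add, pow_succ, ← hxy]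
      ring
    have h2 : ∏ j ∈ range n, (p ^ n - x * p ^ (n + j)) = p ^ (n * n) * poch p x n := by
      rw [pow_mul, poch, show (p ^ n) ^ n = ∏ _j ∈ range n, p ^ n by simp, ← prod_mul_distrib]
      exact prod_congr rfl fun j _ => by ring
    rw [prod_range_add, h1, h2]
    ring
  have hq := sum_antidiagonal_qBinomial hw (n + n) x (p ^ n)
  rw [hprod, Nat.sum_antidiagonal_eq_sum_range_succ
    (fun t u => w t * w u * ((-x) ^ t * (p ^ n) ^ u * p ^ (t.choose 2)))] at hq
  apply mul_left_cancel₀ hA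
  rw [two_mul]
  calc _ = ∑ t ∈ range (n + n).succ, w t * w (n + n - t) *
        ((-x) ^ t * (p ^ n) ^ (n + n - t) * p ^ t.choose 2) := ?_
    _ = _ := by rw [hq]; ring
  have hup : ∀ r, r ≤ n → w (n + r) * w (n + n - (n + r)) *
      ((-x) ^ (n + r) * (p ^ n) ^ (n + n - (n + r)) * p ^ (n + r).choose 2) =
      (-x) ^ n * p ^ (n.choose 2 + n * n) *
        ((-x) ^ r * p ^ r.choose 2 * (w (n - r) * w (n + r))) := by
    intro r hr
    obtain ⟨k, rfl⟩ := Nat.exists_eq_add_of_le hr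
    have e1 : r + k + (r + k) - (r + k + r) = k := by omega
    have e2 : r + k - r = k := by omega
    have e3 : (r + k) * k + (r + k + r).choose 2 =
        (r + k).choose 2 + (r + k) * (r + k) + r.choose 2 := by
      have h1 := two_mul_choose_two (r + k + r)
      have h2 := two_mul_choose_two (r + k)
      have h3 := two_mul_choose_two r
      zify
      push_cast at h1 h2 h3
      linarith
    rw [e1, e2, ← pow_mul]
    calc _ = w (r + k + r) * w k *
          ((-x) ^ (r + k + r) * p ^ ((r + k) * k + (r + k + r).choose 2)) := by
          ring
      _ = _ := by rw [e3]; ring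
  have hdown : ∀ r, r ≤ n → w (n - r) * w (n + n - (n - r)) *
      ((-x) ^ (n - r) * (p ^ n) ^ (n + n - (n - r)) * p ^ (n - r).choose 2) =
      (-x) ^ n * p ^ (n.choose 2 + n * n) *
        ((-y) ^ r * p ^ r.choose 2 * (w (n - r) * w (n + r))) := by
    intro r hr
    obtain ⟨k, rfl⟩ := Nat.exists_eq_add_of_le hr
    have e1 : r + k + (r + k) - k = r + k + r := by omega
    have e2 : r + k - r = k := by omega
    have e3 : (r + k) * (r + k + r) + k.choose 2 =
        (r + k).choose 2 + (r + k) * (r + k) + r.choose 2 + r := by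
      have h1 := two_mul_choose_two k
      have h2 := two_mul_choose_two (r + k)
      have h3 := two_mul_choose_two r
      zify
      push_cast at h1 h2 h3
      linarith
    have e4 : (-x) ^ (r + k) * (-y) ^ r = (-x) ^ k * p ^ r := by
      rw [← hxy, pow_add, mul_pow x y r, neg_pow x r, neg_pow y r]
      have : ((-1 : R) ^ r) * (-1) ^ r = 1 := by rw [← mul_pow]; simp
      calc _ = ((-1 : R) ^ r * (-1) ^ r) * ((-x) ^ k * (x ^ r * y ^ r)) := by ring
        _ = _ := by rw [this, one_mul]
    rw [e2, e1, ← pow_mul]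
    calc _ = w k * w (r + k + r) * ((-x) ^ k * p ^ ((r + k) * (r + k + r) + k.choose 2)) := by
          ring
      _ = w k * w (r + k + r) * (((-x) ^ k * p ^ r) *
            p ^ ((r + k).choose 2 + (r + k) * (r + k) + r.choose 2)) := by
          rw [e3]; ring
      _ = _ := by rw [← e4]; ring
  rw [Nat.succ_eq_add_one, add_assoc, sum_range_add (fun t => w t * w (n + n - t) *
      ((-x) ^ t * (p ^ n) ^ (n + n - t) * p ^ t.choose 2)) n (n + 1),
    ← sum_range_reflect (fun t => w t * w (n + n - t) *
      ((-x) ^ t * (p ^ n) ^ (n + n - t) * p ^ t.choose 2)) n]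
  rw [mul_sum, sum_range_succ', sum_range_succ' (fun r => w (n + r) * w (n + n - (n + r)) *
      ((-x) ^ (n + r) * (p ^ n) ^ (n + n - (n + r)) * p ^ (n + r).choose 2)), ← add_assoc,
      ← sum_add_distrib]
  congr 1
  · refine sum_congr rfl fun r hr => ?_
    have hr' := mem_range.1 hr
    have e : n - 1 - r = n - (r + 1) := by omega
    rw [e, hdown (r + 1) (by omega), hup (r + 1) (by omega), thetaCoeff,
      if_neg (Nat.succ_ne_zero r)]
    ring
  · rw [hup 0 (Nat.zero_le n), thetaCoeff, if_pos rfl]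
    simp

/-! ### The Bailey chain -/

/-- The expansion of a sequence in the kernel of a Bailey pair relative to `p ^ c`, normalised by
shifted factorials: `n ↦ ∑_{r ≤ n} α_r (-p^{r+e})_{n-r} / ((p)_{n-r} (p)_{n+r+c})`. Here `w n`
stands for `1 / (p)_n`. -/
def baileySum (p : R) (w : ℕ → R) (c e : ℕ) (α : ℕ → R) (n : ℕ) : R :=
  ∑ r ∈ range (n + 1), α r * (poch p (-p ^ (r + e)) (n - r) * (w (n - r) * w (n + r + c)))

/-- The Bailey lemma with one parameter `-p ^ e` and the other sent to infinity. -/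
theorem sum_mul_baileySum (hw : ∀ n, w n * poch p p n = 1) {c d e : ℕ} (hde : d + e = c + 1)
    (α : ℕ → R) (n : ℕ) :
    ∑ s ∈ range (n + 1), p ^ (s + d).choose 2 * w (n - s) * baileySum p w c e α s =
      baileySum p w c d (fun r => α r * p ^ (r + d).choose 2) n := by
  simp only [baileySum, mul_sum]
  rw [sum_comm' (t' := range (n + 1)) (s' := fun r => Ico r (n + 1)) (fun s r => by
    simp only [mem_range, mem_Ico]; omega)]
  refine sum_congr rfl fun r hr => ?_
  have hr' := mem_range.1 hr
  rw [sum_Ico_eq_sum_range]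
  obtain ⟨N, rfl⟩ : ∃ N, n = r + N := ⟨n - r, by omega⟩
  have e1 : r + N + 1 - r = N + 1 := by omega
  have e2 : r + N - r = N := by omega
  have key := sum_antidiagonal_chuVandermonde hw N (-p ^ (r + e)) (-p ^ (r + d))
  rw [Nat.sum_antidiagonal_eq_sum_range_succ (fun t u => w t * w u *
      ((-(-p ^ (r + d))) ^ t * p ^ (t.choose 2) * poch p (-p ^ (r + e)) t *
        poch p (-p ^ (r + e) * -p ^ (r + d) * p ^ t) u)), Nat.succ_eq_add_one] at key
  rw [e1, e2]
  calc _ = ∑ t ∈ range (N + 1), α r * p ^ (r + d).choose 2 * w (r + N + r + c) *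
        (w t * w (N - t) * ((-(-p ^ (r + d))) ^ t * p ^ (t.choose 2) * poch p (-p ^ (r + e)) t *
        poch p (-p ^ (r + e) * -p ^ (r + d) * p ^ t) (N - t))) := ?_
    _ = _ := by rw [← mul_sum, key]; ring
  refine sum_congr rfl fun t ht => ?_
  have ht' := mem_range.1 ht
  obtain ⟨u, rfl⟩ : ∃ u, N = t + u := ⟨N - t, by omega⟩
  have e3 : r + (t + u) - (r + t) = u := by omega
  have e4 : r + t - r = t := by omega
  have e5 : t + u - t = u := by omega
  have e6 : (r + t + d).choose 2 = (r + d).choose 2 + ((r + d) * t + t.choose 2) := by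
    have h1 := two_mul_choose_two (r + t + d)
    have h2 := two_mul_choose_two (r + d)
    have h3 := two_mul_choose_two t
    zify
    push_cast at h1 h2 h3
    linarith
  have e7 : -p ^ (r + e) * -p ^ (r + d) * p ^ t = p ^ (r + t + r + c + 1) := by
    rw [neg_mul_neg, ← pow_add, ← pow_add]
    congr 1
    omega
  have e8 := recip_poch_eq_recip_poch_add_mul hw (r + t + r + c) u
  have e9 : r + t + r + c + u = r + (t + u) + r + c := by ring
  rw [e9] at e8
  rw [e3, e4, e5, e6, e7, e8, neg_neg, ← pow_mul, pow_add p ((r + d).choose 2),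
    pow_add p ((r + d) * t)]
  ring

/-- The unit Bailey pair relative to `p`. -/
theorem sum_unit_bailey (hw : ∀ n, w n * poch p p n = 1) (n : ℕ) :
    ∑ r ∈ range (n + 1), (-1) ^ r * p ^ r.choose 2 * (1 - p ^ (2 * r + 1)) *
      (w (n - r) * w (n + r + 1)) = if n = 0 then 1 else 0 := by
  rcases n with _ | n
  · have := one_sub_mul_recip_poch_succ hw 0
    simp only [zero_add, range_one, sum_singleton, if_true]
    simpa [recip_poch_zero hw] using this
  -- Up to the factor `1 - p ^ (n + 1)`, the partial sums have a closed form.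
  have tele : ∀ m, m ≤ n → (1 - p ^ (n + 1)) * ∑ r ∈ range (m + 1), (-1) ^ r * p ^ r.choose 2 *
      (1 - p ^ (2 * r + 1)) * (w (n + 1 - r) * w (n + 1 + r + 1)) =
      (-1) ^ m * p ^ (m + 1).choose 2 * (1 - p ^ (m + 1)) * (w (n - m) * w (n + m + 2)) := by
    intro m
    induction m with
    | zero =>
      intro _
      simp only [zero_add, range_one, sum_singleton, Nat.sub_zero, add_zero]
      rw [← one_sub_mul_recip_poch_succ hw n]
      simp
      ring
    | succ m ih =>
      intro hm
      rw [sum_range_succ, mul_add, ih (by omega)]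
      obtain ⟨k, rfl⟩ : ∃ k, n = m + 1 + k := ⟨n - (m + 1), by omega⟩
      have e1 : m + 1 + k - m = k + 1 := by omega
      have e2 : m + 1 + k + 1 - (m + 1) = k + 1 := by omega
      have e3 : m + 1 + k - (m + 1) = k := by omega
      rw [e1, e2, e3, ← one_sub_mul_recip_poch_succ hw k,
        ← one_sub_mul_recip_poch_succ hw (m + 1 + k + m + 2), Nat.choose_succ_succ' (m + 1) 1,
        Nat.choose_one_right, pow_add p (m + 1) ((m + 1).choose 2)]
      ring_nf
  rw [if_neg (Nat.succ_ne_zero n)]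
  apply one_sub_pow_cancel hw n
  rw [sum_range_succ, mul_add, tele n le_rfl, mul_zero]
  have h := one_sub_mul_recip_poch_succ hw (n + n + 2)
  have e1 : n + 1 - (n + 1) = 0 := by omega
  rw [e1, Nat.sub_self, ← h]
  ring_nf

theorem poch_mul_poch_sub (p b : R) {r n : ℕ} (h : r ≤ n) :
    poch p b r * poch p (b * p ^ r) (n - r) = poch p b n := by
  rw [← poch_add, Nat.add_sub_cancel' h]

theorem baileySum_poch_mul (c : ℕ) (γ : ℕ → R) (n : ℕ) :
    baileySum p w c 1 (fun r => poch p (-p) r * γ r) n =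
      poch p (-p) n * ∑ r ∈ range (n + 1), γ r * (w (n - r) * w (n + r + c)) := by
  rw [baileySum, mul_sum]
  refine sum_congr rfl fun r hr => ?_
  rw [← poch_mul_poch_sub p (-p) (Nat.lt_succ_iff.1 (mem_range.1 hr))]
  have : -p ^ (r + 1) = -p * p ^ r := by ring
  rw [this]
  ring

/-- The change of base in the Bailey lattice, from `p` to `1`. It rests on
`(1 - p^{2r+1}) / ((p)_{n-r} (p)_{n+r+1}) =
1 / ((p)_{n-r} (p)_{n+r}) - p^{2r+1} / ((p)_{n-r-1} (p)_{n+r+1})`. -/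
theorem baileySum_change_base (hw : ∀ n, w n * poch p p n = 1) (γ : ℕ → R) (n : ℕ) :
    baileySum p w 1 1 (fun r => poch p (-p) r * ((1 - p ^ (2 * r + 1)) * γ r)) n =
      baileySum p w 0 1 (fun r => poch p (-p) r *
        (γ r - if r = 0 then 0 else p ^ (2 * r - 1) * γ (r - 1))) n := by
  rw [baileySum_poch_mul, baileySum_poch_mul]
  congr 1
  simp only [sub_mul (γ _), sum_sub_distrib]
  rw [sum_range_succ' (fun r => (if r = 0 then 0 else p ^ (2 * r - 1) * γ (r - 1)) *
    (w (n - r) * w (n + r + 0)))]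
  simp only [if_true, zero_mul, add_zero]
  rw [sum_range_succ, sum_range_succ _ n, add_sub_right_comm, ← sum_sub_distrib]
  congr 1
  · refine sum_congr rfl fun r hr => ?_
    have hr' := mem_range.1 hr
    obtain ⟨k, rfl⟩ : ∃ k, n = r + 1 + k := ⟨n - (r + 1), by omega⟩
    have e1 : r + 1 + k - r = k + 1 := by omega
    have e2 : r + 1 + k - (r + 1) = k := by omega
    have e3 : 2 * (r + 1) - 1 = 2 * r + 1 := by omega
    have e4 : r + 1 + k + (r + 1) = r + 1 + k + r + 1 := by ring
    rw [e1, e2, e3, e4, if_neg (Nat.succ_ne_zero r), Nat.add_sub_cancel,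
      ← one_sub_mul_recip_poch_succ hw k, ← one_sub_mul_recip_poch_succ hw (r + 1 + k + r)]
    ring
  · rw [← one_sub_mul_recip_poch_succ hw (n + n), two_mul]
    ring

/-- The iterated sums `∑_{n ≥ N_1 ≥ ⋯ ≥ N_L} p^{∑_j binom(N_j + δ_j, 2)}
/ ((p)_{n - N_1} (p)_{N_1 - N_2} ⋯ (p)_{N_L})`; the indices of `δ` start at `0`. -/
def chainSum (p : R) (w : ℕ → R) : ℕ → (ℕ → ℕ) → ℕ → R
  | 0, _, n => w n
  | L + 1, δ, n => ∑ s ∈ range (n + 1), p ^ (s + δ 0).choose 2 * w (n - s) *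
      chainSum p w L (fun l => δ (l + 1)) s

/-- The shifts occurring in the exponent of `G_{K,h+1}`: the variable `Ñ_{l+1}` contributes
`binom(Ñ_{l+1}, 2)` if `l + 1 < 2 (h + 1)` is even, and `binom(Ñ_{l+1} + 1, 2)` otherwise. -/
def shift (h l : ℕ) : ℕ := if Odd l ∧ l < 2 * h then 0 else 1

/-- The value of a chain with all shifts `1`: the `L + 1` steps applied to the unit Bailey pair
multiply its `r`-th coefficient by `p ^ ((L + 1) * (r + 1).choose 2)`. -/
theorem chainSum_one_shift (hw : ∀ n, w n * poch p p n = 1) (L n : ℕ) :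
    chainSum p w L (fun _ => 1) n = baileySum p w 1 1 (fun r => poch p (-p) r *
      ((1 - p ^ (2 * r + 1)) *
        ((-1) ^ r * p ^ (r.choose 2 + (L + 1) * (r + 1).choose 2)))) n := by
  induction L generalizing n with
  | zero =>
    -- The start of the chain is itself one step away from the unit Bailey pair.
    have unit : ∀ s, baileySum p w 1 1 (fun r => poch p (-p) r *
        ((-1) ^ r * p ^ r.choose 2 * (1 - p ^ (2 * r + 1)))) s = if s = 0 then 1 else 0 := by
      intro s
      rw [baileySum_poch_mul, sum_unit_bailey hw]
      split_ifs with h <;> simp [h]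
    have step := sum_mul_baileySum hw (rfl : 1 + 1 = 1 + 1) (fun r => poch p (-p) r *
        ((-1) ^ r * p ^ r.choose 2 * (1 - p ^ (2 * r + 1)))) n
    simp only [unit, mul_ite, mul_one, mul_zero, sum_ite_eq', mem_range, Nat.succ_pos, if_true]
      at step
    rw [chainSum]
    convert step using 2
    · simp
    · funext r
      ring
  | succ L ih =>
    rw [chainSum]
    simp only [ih]
    rw [sum_mul_baileySum hw rfl]
    congr 1
    funext r
    ring

/-- The chain with the shifts of `G_{K,h+1}`, where `K = 2 h + t + 1`: after `t + 1` steps relative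
to `p` and the change of base, each of `h` pairs of steps relative to `1` multiplies the `r`-th
coefficient by `p ^ (r * r)`. -/
theorem chainSum_shift (hw : ∀ n, w n * poch p p n = 1) (h t n : ℕ) :
    chainSum p w (2 * h + t) (shift h) n = poch p (-p) n * ∑ r ∈ range (n + 1),
      thetaCoeff (p ^ (2 * h + 2 + t)) (p ^ (h + 1)) (p ^ (h + 1 + t)) r *
        (w (n - r) * w (n + r)) := by
  have main : ∀ n, chainSum p w (2 * h + t) (shift h) n =
      baileySum p w 0 1 (fun r => poch p (-p) r * (p ^ (h * (r * r)) *
        ((-1) ^ r * p ^ (r.choose 2 + (t + 1) * (r + 1).choose 2) - if r = 0 then 0 else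
          p ^ (2 * r - 1) * ((-1) ^ (r - 1) *
            p ^ ((r - 1).choose 2 + (t + 1) * (r - 1 + 1).choose 2))))) n := by
    clear n
    induction h with
    | zero =>
      intro n
      have e : shift 0 = fun _ => 1 := by funext l; simp [shift]
      rw [e, mul_zero, zero_add, chainSum_one_shift hw, baileySum_change_base hw]
      simp
    | succ h ih =>
      intro n
      have e1 : 2 * (h + 1) + t = 2 * h + t + 1 + 1 := by ring
      have e2 : (fun l => shift (h + 1) (l + 1 + 1)) = shift h := by
        funext l
        have : Odd (l + 1 + 1) ↔ Odd l := by simp [Nat.odd_add_one]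
        simp only [shift, this]
        congr 2
        simp only [eq_iff_iff]
        omega
      have e3 : shift (h + 1) (0 + 1) = 0 := by
        rw [shift, if_pos ⟨by decide, by omega⟩]
      have e4 : shift (h + 1) 0 = 1 := by simp [shift]
      rw [e1, chainSum]
      simp only [chainSum, e2, e3, e4, ih]
      simp only [sum_mul_baileySum hw (rfl : 0 + 1 = 0 + 1),
        sum_mul_baileySum hw (rfl : 1 + 0 = 0 + 1)]
      congr 1
      funext r
      have e5 : (h + 1) * (r * r) = h * (r * r) + ((r + 0).choose 2 + (r + 1).choose 2) := by
        have h1 := two_mul_choose_two r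
        have h2 := two_mul_choose_two (r + 1)
        zify
        push_cast at h1 h2 ⊢
        rw [add_zero]
        linarith
      rw [e5, pow_add p (h * (r * r)), pow_add p ((r + 0).choose 2)]
      ring
  rw [main, baileySum_poch_mul]
  congr 1
  refine sum_congr rfl fun r _ => ?_
  rw [add_zero]
  congr 1
  rcases r with _ | r
  · simp [thetaCoeff]
  · simp only [thetaCoeff, if_neg (Nat.succ_ne_zero r), Nat.add_sub_cancel]
    have e : 2 * (r + 1) - 1 = 2 * r + 1 := by omega
    have h1 := two_mul_choose_two r
    have h2 := two_mul_choose_two (r + 1)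
    have h3 := two_mul_choose_two (r + 1 + 1)
    push_cast at h1 h2 h3
    have hx : (h + 1) * (r + 1) + (2 * h + 2 + t) * (r + 1).choose 2 =
        h * ((r + 1) * (r + 1)) + (2 * r + 1) + (r.choose 2 + (t + 1) * (r + 1).choose 2) := by
      zify
      nlinarith
    have hy : (h + 1 + t) * (r + 1) + (2 * h + 2 + t) * (r + 1).choose 2 =
        h * ((r + 1) * (r + 1)) + ((r + 1).choose 2 + (t + 1) * (r + 1 + 1).choose 2) := by
      zify
      nlinarith
    rw [e, neg_pow (p ^ (h + 1)), neg_pow (p ^ (h + 1 + t)), ← pow_mul, ← pow_mul, ← pow_mul,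
      mul_assoc, ← pow_add, mul_assoc, ← pow_add, hx, hy]
    ring

end Algebra

/-! ### The multiple sum as a nested sum -/

/-- `∑_j binom(N_j + δ_j, 2)`, where `N_j` is the sum of the entries of `m` from the `j`-th on. -/
def shiftedExponent {L : ℕ} (δ : ℕ → ℕ) (m : Fin L → ℕ) : ℕ :=
  ∑ l : Fin L, ((∑ l' : Fin L, if l ≤ l' then m l' else 0) + δ l).choose 2

theorem shiftedExponent_cons {L : ℕ} (δ : ℕ → ℕ) (a : ℕ) (m : Fin L → ℕ) :
    shiftedExponent δ (Fin.cons a m : Fin (L + 1) → ℕ) =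
      (a + ∑ l, m l + δ 0).choose 2 + shiftedExponent (fun l => δ (l + 1)) m := by
  simp [shiftedExponent, Fin.sum_univ_succ]

theorem sum_le_shiftedExponent {L : ℕ} {δ : ℕ → ℕ} (hδ : δ 0 = 1) (m : Fin L → ℕ) :
    ∑ l, m l ≤ shiftedExponent δ m := by
  cases L with
  | zero => simp
  | succ L =>
    rw [← Fin.cons_self_tail m, shiftedExponent_cons, hδ, Nat.choose_succ_succ' _ 1,
      Nat.choose_one_right, Fin.sum_univ_succ]
    simp only [Fin.cons_zero, Fin.cons_succ]
    omega

theorem sum_antidiagonalTuple_succ {M : Type*} [AddCommMonoid M] (k n : ℕ)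
    (f : (Fin (k + 1) → ℕ) → M) :
    ∑ m ∈ Nat.antidiagonalTuple (k + 1) n, f m =
      ∑ x ∈ antidiagonal n, ∑ m ∈ Nat.antidiagonalTuple k x.2, f (Fin.cons x.1 m) := by
  rw [sum_sigma']
  refine sum_bij' (fun m _ => ⟨(m 0, ∑ l, Fin.tail m l), Fin.tail m⟩)
    (fun x _ => Fin.cons x.1.1 x.2) ?_ ?_ ?_ ?_ ?_
  · intro m hm
    rw [Nat.mem_antidiagonalTuple, Fin.sum_univ_succ] at hm
    simp [Nat.mem_antidiagonalTuple, Fin.tail, hm]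
  · rintro ⟨⟨a, b⟩, m⟩ hx
    simp only [mem_sigma, HasAntidiagonal.mem_antidiagonal, Nat.mem_antidiagonalTuple] at hx
    simp [Nat.mem_antidiagonalTuple, Fin.sum_univ_succ, hx.1, hx.2]
  · intro m _
    simp
  · rintro ⟨⟨a, b⟩, m⟩ hx
    simp only [mem_sigma, HasAntidiagonal.mem_antidiagonal, Nat.mem_antidiagonalTuple] at hx
    simp [hx.2]
  · intro m _
    simp

/-- The part of the multiple sum coming from the `m` with a given value of `m_1 + ⋯ + m_L`. -/
def levelSum {R : Type*} [CommRing R] (p : R) (w : ℕ → R) (L : ℕ) (δ : ℕ → ℕ) (s : ℕ) : R :=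
  ∑ m ∈ Nat.antidiagonalTuple L s, p ^ shiftedExponent δ m * ∏ l, w (m l)

theorem chainSum_eq_sum_levelSum {R : Type*} [CommRing R] (p : R) (w : ℕ → R) (L : ℕ)
    (δ : ℕ → ℕ) (n : ℕ) :
    chainSum p w L δ n = ∑ x ∈ antidiagonal n, w x.1 * levelSum p w L δ x.2 := by
  induction L generalizing δ n with
  | zero =>
    rw [chainSum, Nat.sum_antidiagonal_eq_sum_range_succ (fun a b => w a * levelSum p w 0 δ b),
      sum_range_succ, sum_eq_zero]
    · simp [levelSum, shiftedExponent]
    · intro r hr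
      obtain ⟨k, hk⟩ : ∃ k, n - r = k + 1 := ⟨n - r - 1, by have := mem_range.1 hr; omega⟩
      simp [levelSum, hk, Nat.antidiagonalTuple_zero_succ]
  | succ L ih =>
    have hlev : ∀ s, levelSum p w (L + 1) δ s =
        p ^ (s + δ 0).choose 2 * chainSum p w L (fun l => δ (l + 1)) s := by
      intro s
      rw [ih, levelSum, sum_antidiagonalTuple_succ, mul_sum]
      refine sum_congr rfl fun x hx => ?_
      rw [levelSum, mul_sum, mul_sum]
      refine sum_congr rfl fun m hm => ?_
      rw [shiftedExponent_cons, Nat.mem_antidiagonalTuple.1 hm, mem_antidiagonal.1 hx,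
        Fin.prod_univ_succ, pow_add]
      simp only [Fin.cons_zero, Fin.cons_succ]
      ring
    rw [chainSum, ← Nat.sum_antidiagonal_swap]
    simp only [Prod.fst_swap, Prod.snd_swap]
    rw [Nat.sum_antidiagonal_eq_sum_range_succ (fun a b => w b * levelSum p w (L + 1) δ a)]
    refine sum_congr rfl fun s _ => ?_
    rw [hlev]
    ring

/-- The coefficient of `m_{l+1}` in `∑_j (2 δ_j - 1) Ñ_j` is its coefficient in
`M̃ + 2 L̃_{2(h+1)}`. -/
theorem sum_range_two_mul_shift_sub_one (h l : ℕ) :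
    ∑ j ∈ range (l + 1), (2 * (shift h j : ℤ) - 1) =
      ((if Odd (l + 1) then 1 else 0) +
        2 * (if 2 * (h + 1) ≤ l + 1 then (l + 1 - 2 * (h + 1)) / 2 + 1 else 0) : ℕ) := by
  induction l with
  | zero =>
    rw [if_neg (by omega : ¬2 * (h + 1) ≤ 0 + 1)]
    simp [shift]
  | succ l ih =>
    rw [sum_range_succ, ih]
    simp only [shift, Nat.odd_iff]
    split_ifs <;> push_cast <;> omega

theorem qExponent_eq_shiftedExponent {K : ℕ} (h : ℕ) (m : Fin (K - 1) → ℕ) :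
    qExponent (h + 1) m = shiftedExponent (shift h) m := by
  have hN : ∀ l : Fin (K - 1), tildeN m ((l : ℕ) + 1) =
      ∑ l' : Fin (K - 1), if l ≤ l' then m l' else 0 := by
    intro l
    simp [tildeN]
  have hsq : ∑ j ∈ Icc 1 (K - 1), tildeN m j ^ 2 =
      ∑ l : Fin (K - 1), tildeN m ((l : ℕ) + 1) ^ 2 := by
    rw [← Finset.sum_range (fun l => tildeN m (l + 1) ^ 2)]
    refine sum_nbij' (fun j => j - 1) (fun l => l + 1) ?_ ?_ ?_ ?_ ?_ <;> intro j hj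
    · have := mem_Icc.1 hj
      exact mem_range.2 (by omega)
    · have := mem_range.1 hj
      exact mem_Icc.2 (by omega)
    · have := mem_Icc.1 hj
      omega
    · omega
    · have := mem_Icc.1 hj
      rw [Nat.sub_add_cancel this.1]
  have hlin : ∑ l : Fin (K - 1), (2 * (shift h l : ℤ) - 1) * tildeN m ((l : ℕ) + 1) =
      (tildeM m + 2 * tildeL m (2 * (h + 1)) : ℕ) := by
    have hterm : ∀ l' : Fin (K - 1), ∑ l : Fin (K - 1),
        (2 * (shift h l : ℤ) - 1) * (if l ≤ l' then m l' else 0 : ℕ) =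
        (∑ j ∈ range ((l' : ℕ) + 1), (2 * (shift h j : ℤ) - 1)) * m l' := by
      intro l'
      rw [sum_mul]
      have hsub : range ((l' : ℕ) + 1) = (range (K - 1)).filter (fun j => j ≤ (l' : ℕ)) := by
        ext j
        have := l'.isLt
        simp only [mem_filter, mem_range]
        omega
      rw [hsub, sum_filter, Finset.sum_range]
      refine sum_congr rfl fun l _ => ?_
      simp only [Fin.le_def]
      split_ifs <;> simp
    simp only [hN]
    push_cast
    simp only [mul_sum]
    rw [sum_comm]
    have : ∀ l' : Fin (K - 1), ∑ l : Fin (K - 1),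
        (2 * (shift h l : ℤ) - 1) * (if l ≤ l' then (m l' : ℤ) else 0) =
        ((if Odd ((l' : ℕ) + 1) then m l' else 0) + 2 * (if 2 * (h + 1) ≤ (l' : ℕ) + 1 then
          (((l' : ℕ) + 1 - 2 * (h + 1)) / 2 + 1) * m l' else 0) : ℕ) := by
      intro l'
      have := hterm l'
      rw [sum_range_two_mul_shift_sub_one] at this
      push_cast at this
      push_cast
      rw [this]
      split_ifs <;> ring
    rw [sum_congr rfl fun l' _ => this l', ← Nat.cast_sum, sum_add_distrib, ← mul_sum]
    simp [tildeM, tildeL]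
  have htwo : 2 * (shiftedExponent (shift h) m : ℤ) =
      ∑ l : Fin (K - 1), (tildeN m ((l : ℕ) + 1) ^ 2 +
        (2 * (shift h l : ℤ) - 1) * tildeN m ((l : ℕ) + 1)) := by
    rw [shiftedExponent]
    push_cast
    rw [mul_sum]
    refine sum_congr rfl fun l _ => ?_
    rw [two_mul_choose_two, hN l]
    push_cast
    rcases (by unfold shift; split_ifs <;> simp : shift h l = 0 ∨ shift h l = 1) with hs | hs <;>
    · rw [hs]
      push_cast
      ring
  rw [sum_add_distrib, hlin] at htwo
  have hd := two_dvd_doubleExponent m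
  unfold qExponent
  have hde : doubleExponent m = ∑ l : Fin (K - 1), tildeN m ((l : ℕ) + 1) ^ 2 + tildeM m := by
    rw [doubleExponent, hsq]
  zify at hde
  have h2 := Nat.div_mul_cancel hd
  push_cast at htwo
  zify at h2 ⊢
  linarith

open Filter Topology

/-! ### Congruences modulo powers -/

section Divisibility

variable {R : Type*} [CommRing R] {p d : R} {w : ℕ → R}

theorem dvd_mul_sub_one {a b : R} (ha : d ∣ a - 1) (hb : d ∣ b - 1) : d ∣ a * b - 1 := by
  have : a * b - 1 = (a - 1) * b + (b - 1) := by ring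
  rw [this]
  exact dvd_add (ha.mul_right b) hb

theorem dvd_poch_sub_one {b : R} (hb : d ∣ b) (p : R) (n : ℕ) : d ∣ poch p b n - 1 := by
  induction n with
  | zero => simp
  | succ n ih =>
    rw [poch_succ]
    refine dvd_mul_sub_one ih ?_
    have : 1 - b * p ^ n - 1 = b * -p ^ n := by ring
    rw [this]
    exact hb.mul_right _

theorem pow_dvd_poch_mul_recip_sub_one (hw : ∀ n, w n * poch p p n = 1) {j m n : ℕ}
    (hjm : j ≤ m + 1) (hjn : j ≤ n + 1) : p ^ j ∣ poch p p n * w m - 1 := by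
  rcases le_total m n with h | h
  · obtain ⟨k, rfl⟩ := Nat.exists_eq_add_of_le h
    have e : poch p p (m + k) * w m = poch p (p ^ (m + 1)) k := by
      rw [recip_poch_eq_recip_poch_add_mul hw m k, ← mul_assoc, mul_comm (poch p p _), hw, one_mul]
    rw [e]
    exact dvd_poch_sub_one (pow_dvd_pow p hjm) p k
  · obtain ⟨k, rfl⟩ := Nat.exists_eq_add_of_le h
    have e : poch p p n * w (n + k) * poch p (p ^ (n + 1)) k = 1 := by
      rw [mul_assoc, ← recip_poch_eq_recip_poch_add_mul hw n k, mul_comm, hw]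
    have e2 : poch p p n * w (n + k) - 1 =
        -(poch p p n * w (n + k)) * (poch p (p ^ (n + 1)) k - 1) := by
      rw [mul_sub, neg_mul, e]
      ring
    rw [e2]
    exact (dvd_poch_sub_one (pow_dvd_pow p hjn) p k).mul_left _

/-- The Bailey kernel relative to `1` is close to `1 / (p)_∞ ^ 2`. -/
theorem pow_dvd_poch_sq_mul_sum_sub (hw : ∀ n, w n * poch p p n = 1) (hd : d ∣ p) {θ : ℕ → R}
    (hθ : ∀ r, d ^ r ∣ θ r) (n : ℕ) :
    d ^ n ∣ poch p p n * (poch p p n * ∑ r ∈ range (n + 1), θ r * (w (n - r) * w (n + r))) -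
      ∑ r ∈ range (n + 1), θ r := by
  rw [mul_sum, mul_sum, ← sum_sub_distrib]
  refine dvd_sum fun r hr => ?_
  have hr' := mem_range.1 hr
  have e : poch p p n * (poch p p n * (θ r * (w (n - r) * w (n + r)))) - θ r =
      θ r * (poch p p n * w (n - r) * (poch p p n * w (n + r)) - 1) := by ring
  have hn : d ^ n = d ^ r * d ^ (n - r) := by
    rw [← pow_add]
    congr 1
    omega
  rw [e, hn]
  exact mul_dvd_mul (hθ r) (dvd_trans (pow_dvd_pow_of_dvd hd _) (dvd_mul_sub_one
    (pow_dvd_poch_mul_recip_sub_one hw (by omega) (by omega))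
    (pow_dvd_poch_mul_recip_sub_one hw (by omega) (by omega))))

theorem pow_dvd_thetaCoeff {x y : R} (hx : d ∣ x) (hy : d ∣ y) (r : ℕ) :
    d ^ r ∣ thetaCoeff p x y r := by
  unfold thetaCoeff
  split_ifs with h
  · simp [h]
  · exact dvd_add ((pow_dvd_pow_of_dvd ((dvd_neg).2 hx) r).mul_right _)
      ((pow_dvd_pow_of_dvd ((dvd_neg).2 hy) r).mul_right _)

end Divisibility

/-! ### Limits of power series -/

section Limits

theorem constantCoeff_poch {p b : ℤ⟦X⟧} (hb : PowerSeries.constantCoeff b = 0) (n : ℕ) :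
    PowerSeries.constantCoeff (poch p b n) = 1 := by
  simp [poch, map_prod, hb]

theorem recip_poch_mul {p : ℤ⟦X⟧} (hp : PowerSeries.constantCoeff p = 0) (n : ℕ) :
    recip (poch p p n) * poch p p n = 1 := by
  rw [mul_comm, mul_recip _ (constantCoeff_poch hp n)]

theorem tendsto_zero_of_X_pow_dvd {f : ℕ → ℤ⟦X⟧} (hf : ∀ n, q ^ n ∣ f n) :
    Tendsto f atTop (𝓝 0) := by
  rw [PowerSeries.WithPiTopology.tendsto_iff_coeff_tendsto]
  intro d
  refine tendsto_const_nhds.congr' ?_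
  filter_upwards [eventually_gt_atTop d] with n hn
  rw [map_zero, PowerSeries.X_pow_dvd_iff.1 (hf n) d hn]

theorem tendsto_of_X_pow_dvd_sub {f g : ℕ → ℤ⟦X⟧} {a : ℤ⟦X⟧} (hf : Tendsto f atTop (𝓝 a))
    (h : ∀ n, q ^ n ∣ f n - g n) : Tendsto g atTop (𝓝 a) := by
  simpa using hf.sub (tendsto_zero_of_X_pow_dvd h)

theorem multipliable_of_X_pow_dvd_sub_one {f : ℕ → ℤ⟦X⟧} (h : ∀ n, q ^ n ∣ f n - 1) :
    Multipliable f := by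
  have e : f = fun n => 1 + (f n - 1) := by funext n; ring
  rw [e]
  apply PowerSeries.WithPiTopology.multipliable_one_add_of_tendsto_order_atTop_nhds_top
  refine tendsto_nhds_top_mono ENat.tendsto_natCast_nhds_top (Eventually.of_forall fun n => ?_)
  exact PowerSeries.nat_le_order _ _ fun i hi => PowerSeries.X_pow_dvd_iff.1 (h n) i hi

theorem tendsto_poch {p b : ℤ⟦X⟧} (hp : q ∣ p) :
    Tendsto (fun n => poch p b n) atTop (𝓝 (∏' n, (1 - b * p ^ n))) := by
  refine (multipliable_of_X_pow_dvd_sub_one fun n => ?_).tendsto_prod_tprod_nat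
  have e : 1 - b * p ^ n - 1 = -b * p ^ n := by ring
  rw [e]
  exact (pow_dvd_pow_of_dvd hp n).mul_left _

/-- Jacobi's triple product identity. -/
theorem tendsto_sum_thetaCoeff {p x y : ℤ⟦X⟧} (hp : p ≠ 0) (hx : q ∣ x) (hy : q ∣ y)
    (hxy : x * y = p) :
    Tendsto (fun n => ∑ r ∈ range (n + 1), thetaCoeff p x y r) atTop
      (𝓝 ((∏' n, (1 - p * p ^ n)) * ((∏' n, (1 - x * p ^ n)) * ∏' n, (1 - y * p ^ n)))) := by
  have hqp : q ∣ p := hxy ▸ hx.mul_right y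
  have hw := recip_poch_mul (PowerSeries.X_dvd_iff.1 hqp)
  refine tendsto_of_X_pow_dvd_sub ?_
    (pow_dvd_poch_sq_mul_sum_sub hw hqp (pow_dvd_thetaCoeff (p := p) hx hy))
  simp only [finite_jacobi hw hxy hp]
  refine (tendsto_poch hqp).mul ?_
  have h1 : Tendsto (fun n => poch p p n * recip (poch p p (2 * n))) atTop (𝓝 1) := by
    refine tendsto_of_X_pow_dvd_sub tendsto_const_nhds fun n => ?_
    rw [← dvd_neg, neg_sub]
    exact dvd_trans (pow_dvd_pow_of_dvd hqp n)
      (pow_dvd_poch_mul_recip_sub_one hw (by omega) (by omega))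
  simpa only [one_mul, mul_assoc] using
    h1.mul ((tendsto_poch (b := x) hqp).mul (tendsto_poch (b := y) hqp))

theorem recip_mul_eq {f g : ℤ⟦X⟧} (h : f * g = 1) (hf : PowerSeries.constantCoeff f = 1) :
    recip f = g := by
  have h2 := mul_recip f hf
  calc recip f = (f * g) * recip f := by rw [h, one_mul]
    _ = (f * recip f) * g := by ring
    _ = g := by rw [h2, one_mul]

theorem summandG_eq (K h : ℕ) (m : Fin (K - 1) → ℕ) :
    summandG K (h + 1) 1 m = q ^ shiftedExponent (shift h) m * ∏ l, recip (poch q q (m l)) := by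
  rw [summandG, one_pow, mul_one, qExponent_eq_shiftedExponent]
  congr 1
  refine recip_mul_eq ?_ ?_
  · rw [← prod_mul_distrib]
    exact prod_eq_one fun l _ => mul_recip _ (constantCoeff_qPochhammer _)
  · rw [map_prod]
    exact prod_eq_one fun l _ => constantCoeff_qPochhammer _

theorem X_pow_sum_dvd_summandG (K h : ℕ) (m : Fin (K - 1) → ℕ) :
    q ^ (∑ l, m l) ∣ summandG K (h + 1) 1 m := by
  rw [summandG_eq]
  exact (pow_dvd_pow _ (sum_le_shiftedExponent (by simp [shift]) m)).mul_right _

theorem summable_summandG (K h : ℕ) : Summable (summandG K (h + 1) 1) := by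
  rw [PowerSeries.WithPiTopology.summable_iff_summable_coeff]
  intro d
  refine summable_of_hasFiniteSupport
    (((range (d + 1)).biUnion (Nat.antidiagonalTuple (K - 1))).finite_toSet.subset ?_)
  intro m hm
  rw [mem_coe, mem_biUnion]
  refine ⟨∑ l, m l, ?_, Nat.mem_antidiagonalTuple.2 rfl⟩
  by_contra hlt
  refine hm (PowerSeries.X_pow_dvd_iff.1 (X_pow_sum_dvd_summandG K h m) d ?_)
  simp only [mem_range] at hlt
  omega

theorem tendsto_sum_levelSum (K h : ℕ) :
    Tendsto (fun n => ∑ s ∈ range (n + 1),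
      levelSum q (fun m => recip (poch q q m)) (K - 1) (shift h) s) atTop
      (𝓝 (G K (h + 1) 1)) := by
  have hmono : Monotone fun n => (range (n + 1)).biUnion (Nat.antidiagonalTuple (K - 1)) :=
    fun a b hab => biUnion_subset_biUnion_of_subset_left _ (range_mono (by omega))
  have htop : Tendsto (fun n => (range (n + 1)).biUnion (Nat.antidiagonalTuple (K - 1)))
      atTop atTop := by
    refine tendsto_atTop_finset_of_monotone hmono fun m => ⟨∑ l, m l, ?_⟩
    rw [mem_biUnion]
    exact ⟨_, self_mem_range_succ _, Nat.mem_antidiagonalTuple.2 rfl⟩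
  refine ((summable_summandG K h).hasSum.comp htop).congr fun n => ?_
  rw [Function.comp_apply, sum_biUnion]
  · exact sum_congr rfl fun s _ => sum_congr rfl fun m _ => summandG_eq K h m
  · intro a _ b _ hab
    rw [Function.onFun, disjoint_left]
    intro m ha hb
    exact hab ((Nat.mem_antidiagonalTuple.1 ha).symm.trans (Nat.mem_antidiagonalTuple.1 hb))

theorem tendsto_poch_mul_chainSum (K h : ℕ) :
    Tendsto (fun n => poch q q n *
      chainSum q (fun m => recip (poch q q m)) (K - 1) (shift h) n) atTop
      (𝓝 (G K (h + 1) 1)) := by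
  refine tendsto_of_X_pow_dvd_sub (tendsto_sum_levelSum K h) fun n => ?_
  have hw := recip_poch_mul (p := q) PowerSeries.constantCoeff_X
  rw [chainSum_eq_sum_levelSum, ← Nat.sum_antidiagonal_eq_sum_range_succ_mk
    (fun x => levelSum q (fun m => recip (poch q q m)) (K - 1) (shift h) x.1),
    ← Nat.sum_antidiagonal_swap, mul_sum, ← sum_sub_distrib]
  refine dvd_sum fun x hx => ?_
  have e : ∀ a b c : ℤ⟦X⟧, a - b * (c * a) = -(a * (b * c - 1)) := fun a b c => by ring
  rw [Prod.fst_swap, e, dvd_neg, ← HasAntidiagonal.mem_antidiagonal.1 hx, add_comm, pow_add]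
  refine mul_dvd_mul (dvd_sum fun m hm => ?_)
    (pow_dvd_poch_mul_recip_sub_one hw (by omega) (by omega))
  have := X_pow_sum_dvd_summandG K h m
  rwa [Nat.mem_antidiagonalTuple.1 hm, summandG_eq] at this

/-- The multiple sum as a quotient of infinite products, for `K = 2 h + t + 1` and `i = h + 1`. -/
theorem tprod_mul_G (h t : ℕ) :
    (∏' n, (1 - q ^ (n + 1))) * G (2 * h + t + 1) (h + 1) 1 =
      (∏' n, (1 + q ^ (n + 1))) *
        ((∏' k, (1 - q ^ ((2 * h + 2 + t) * k + (2 * h + 2 + t)))) *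
          ((∏' k, (1 - q ^ ((2 * h + 2 + t) * k + (h + 1)))) *
            ∏' k, (1 - q ^ ((2 * h + 2 + t) * k + (h + 1 + t))))) := by
  have hw := recip_poch_mul (p := q) PowerSeries.constantCoeff_X
  have h1 := (tendsto_poch (b := q) dvd_rfl).mul (tendsto_poch_mul_chainSum (2 * h + t + 1) h)
  have hqx : q ∣ q ^ (h + 1) := dvd_pow_self _ (by omega)
  have hqy : q ∣ q ^ (h + 1 + t) := dvd_pow_self _ (by omega)
  have hxy : q ^ (h + 1) * q ^ (h + 1 + t) = q ^ (2 * h + 2 + t) := by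
    rw [← pow_add]
    congr 1
    ring
  have h2 := tendsto_sum_thetaCoeff (pow_ne_zero _ PowerSeries.X_ne_zero) hqx hqy hxy
  have h3 := (tendsto_poch (b := -q) dvd_rfl).mul h2
  have h4 := tendsto_of_X_pow_dvd_sub h3 (g := fun n => poch q q n * (poch q q n *
      chainSum q (fun m => recip (poch q q m)) (2 * h + t) (shift h) n)) fun n => by
    rw [chainSum_shift hw, ← dvd_neg, neg_sub]
    have e : ∀ a b c s : ℤ⟦X⟧, a * (a * (b * c)) - b * s = b * (a * (a * c) - s) :=
      fun a b c s => by ring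
    rw [e]
    exact (pow_dvd_poch_sq_mul_sum_sub hw dvd_rfl (pow_dvd_thetaCoeff hqx hqy) n).mul_left _
  have h5 := tendsto_nhds_unique h1 h4
  convert h5 using 5 <;> ring_nf

end Limits

/-! ### Infinite products -/

section Products

theorem X_pow_dvd_one_sub_X_pow_sub_one {n m : ℕ} (h : n ≤ m) : q ^ n ∣ 1 - q ^ m - 1 := by
  rw [sub_sub_cancel_left, dvd_neg]
  exact pow_dvd_pow _ h

theorem X_pow_dvd_one_add_X_pow_sub_one {n m : ℕ} (h : n ≤ m) : q ^ n ∣ 1 + q ^ m - 1 := by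
  rw [add_sub_cancel_left]
  exact pow_dvd_pow _ h

theorem one_sub_X_pow_mul_recip (n : ℕ) : (1 - q ^ (n + 1)) * recip (1 - q ^ (n + 1)) = 1 :=
  mul_recip _ (constantCoeff_one_sub_q_pow _ (Nat.succ_ne_zero n))

theorem X_pow_dvd_recip_sub_one (n : ℕ) : q ^ n ∣ recip (1 - q ^ (n + 1)) - 1 := by
  have h := one_sub_X_pow_mul_recip n
  have e : recip (1 - q ^ (n + 1)) - 1 = q ^ n * (q * recip (1 - q ^ (n + 1))) := by
    rw [← sub_eq_zero, ← sub_eq_zero.2 h]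
    ring
  exact ⟨_, e⟩

theorem multipliable_one_add_X_pow : Multipliable fun n : ℕ => 1 + q ^ (n + 1) :=
  multipliable_of_X_pow_dvd_sub_one fun n => X_pow_dvd_one_add_X_pow_sub_one n.le_succ

theorem multipliable_one_sub_X_pow : Multipliable fun n : ℕ => 1 - q ^ (n + 1) :=
  multipliable_of_X_pow_dvd_sub_one fun n => X_pow_dvd_one_sub_X_pow_sub_one n.le_succ

theorem multipliable_factorRR (K i : ℕ) : Multipliable fun n : ℕ => factorRR K i (n + 1) := by
  refine multipliable_of_X_pow_dvd_sub_one fun n => ?_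
  unfold factorRR
  split_ifs
  · exact X_pow_dvd_recip_sub_one n
  · simp

theorem multipliable_factorOver (κ : ℕ) : Multipliable fun n : ℕ => factorOver κ (n + 1) := by
  refine multipliable_of_X_pow_dvd_sub_one fun n => ?_
  unfold factorOver
  split_ifs
  · simp
  · exact dvd_mul_sub_one (X_pow_dvd_one_add_X_pow_sub_one n.le_succ) (X_pow_dvd_recip_sub_one n)

theorem multipliable_ite {f : ℕ → ℤ⟦X⟧} (hf : ∀ n, q ^ n ∣ f n - 1) (P : ℕ → Prop)
    [DecidablePred P] : Multipliable fun n => if P n then f n else 1 := by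
  refine multipliable_of_X_pow_dvd_sub_one fun n => ?_
  split_ifs
  · exact hf n
  · simp

/-- A product over the positive integers in a residue class mod `M`. -/
theorem tprod_residue (f : ℕ → ℤ⟦X⟧) {M a : ℕ} (ha : 1 ≤ a) (haM : a ≤ M) :
    ∏' n : ℕ, (if (n + 1) % M = a % M then f (n + 1) else 1) = ∏' k, f (M * k + a) := by
  have hinj : Function.Injective fun k => M * k + a - 1 := by
    intro k l hkl
    have : M * k = M * l := by
      have : M * k + a - 1 = M * l + a - 1 := hkl
      omega
    exact Nat.eq_of_mul_eq_mul_left (by omega) this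
  rw [← hinj.tprod_eq]
  · refine tprod_congr fun k => ?_
    have e : M * k + a - 1 + 1 = M * k + a := by omega
    rw [e, if_pos (Nat.mul_add_mod M k a)]
  · intro n hn
    rw [Function.mem_mulSupport] at hn
    have hmod : (n + 1) % M = a % M := by
      by_contra hne
      exact hn (if_neg hne)
    have hdiv := Nat.div_add_mod (n + 1) M
    rcases haM.lt_or_eq with hlt | rfl
    · rw [hmod, Nat.mod_eq_of_lt hlt] at hdiv
      exact ⟨(n + 1) / M, by dsimp only; omega⟩
    · rw [hmod, Nat.mod_self] at hdiv
      obtain ⟨k, hk⟩ : ∃ k, (n + 1) / a = k + 1 := by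
        refine Nat.exists_eq_succ_of_ne_zero fun h0 => ?_
        rw [h0] at hdiv
        omega
      rw [hk, mul_add, mul_one] at hdiv
      exact ⟨k, by dsimp only; omega⟩

theorem tprod_factorRR_mul {h t : ℕ} (ht : 1 ≤ t) :
    (∏' n, (1 - q ^ (n + 1))) * ∏' n, factorRR (2 * h + t + 1) (h + 1) (n + 1) =
      (∏' k, (1 - q ^ ((2 * h + 2 + t) * k + (2 * h + 2 + t)))) *
          ((∏' k, (1 - q ^ ((2 * h + 2 + t) * k + (h + 1)))) *
            ∏' k, (1 - q ^ ((2 * h + 2 + t) * k + (h + 1 + t)))) := by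
  set M := 2 * h + 2 + t with hM
  have hf : ∀ n, q ^ n ∣ 1 - q ^ (n + 1) - 1 := fun n => X_pow_dvd_one_sub_X_pow_sub_one n.le_succ
  have hm : ∀ a, Multipliable fun n : ℕ => if (n + 1) % M = a % M then 1 - q ^ (n + 1) else 1 :=
    fun a => multipliable_ite hf _
  rw [← tprod_residue (fun n => 1 - q ^ n) (by omega : 1 ≤ M) le_rfl,
    ← tprod_residue (fun n => 1 - q ^ n) (by omega : 1 ≤ h + 1) (by omega : h + 1 ≤ M),
    ← tprod_residue (fun n => 1 - q ^ n) (by omega : 1 ≤ h + 1 + t) (by omega : h + 1 + t ≤ M),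
    ← (hm _).tprod_mul (hm _), ← (hm _).tprod_mul ((hm _).mul (hm _)),
    ← multipliable_one_sub_X_pow.tprod_mul (multipliable_factorRR _ _)]
  refine tprod_congr fun n => ?_
  have c0 : ((n + 1 : ℕ) : ℤ) ≡ 0 [ZMOD ((2 * h + t + 1 : ℕ) : ℤ) + 1] ↔ (n + 1) % M = M % M := by
    have e : ((2 * h + t + 1 : ℕ) : ℤ) + 1 = (M : ℕ) := by push_cast [hM]; ring
    rw [e, Nat.mod_self]
    exact Int.natCast_modEq_iff (b := 0)
  have c1 : ((n + 1 : ℕ) : ℤ) ≡ ((h + 1 : ℕ) : ℤ) [ZMOD ((2 * h + t + 1 : ℕ) : ℤ) + 1] ↔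
      (n + 1) % M = (h + 1) % M := by
    have e : ((2 * h + t + 1 : ℕ) : ℤ) + 1 = (M : ℕ) := by push_cast [hM]; ring
    rw [e, Int.natCast_modEq_iff]
    rfl
  have c2 : ((n + 1 : ℕ) : ℤ) ≡ -((h + 1 : ℕ) : ℤ) [ZMOD ((2 * h + t + 1 : ℕ) : ℤ) + 1] ↔
      (n + 1) % M = (h + 1 + t) % M := by
    have e : ((2 * h + t + 1 : ℕ) : ℤ) + 1 = (M : ℕ) := by push_cast [hM]; ring
    have e2 : -((h + 1 : ℕ) : ℤ) ≡ ((h + 1 + t : ℕ) : ℤ) [ZMOD (M : ℕ)] := by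
      rw [Int.modEq_iff_dvd]
      exact ⟨1, by push_cast [hM]; ring⟩
    rw [e]
    exact ⟨fun h => Int.natCast_modEq_iff.1 (h.trans e2),
      fun h => (Int.natCast_modEq_iff.2 h).trans e2.symm⟩
  have r0 : M % M = 0 := Nat.mod_self M
  have r1 : (h + 1) % M = h + 1 := Nat.mod_eq_of_lt (by omega)
  have r2 : (h + 1 + t) % M = h + 1 + t := Nat.mod_eq_of_lt (by omega)
  unfold factorRR
  simp only [c0, c1, c2, r0, r1, r2]
  have hr := one_sub_X_pow_mul_recip n
  split_ifs <;> first | omega | simp [hr]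

theorem tprod_factorOver_mul (h : ℕ) :
    (∏' n, (1 - q ^ (n + 1))) * (∏' n, factorOver (h + 1) (n + 1)) *
        ∏' k, (1 + q ^ ((h + 1) * k + (h + 1))) =
      (∏' n, (1 + q ^ (n + 1))) * ∏' k, (1 - q ^ ((h + 1) * k + (h + 1))) := by
  have hm := multipliable_ite (f := fun n => 1 - q ^ (n + 1))
    (fun n => X_pow_dvd_one_sub_X_pow_sub_one n.le_succ)
    (fun n => (n + 1) % (h + 1) = (h + 1) % (h + 1))
  have hp := multipliable_ite (f := fun n => 1 + q ^ (n + 1))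
    (fun n => X_pow_dvd_one_add_X_pow_sub_one n.le_succ)
    (fun n => (n + 1) % (h + 1) = (h + 1) % (h + 1))
  rw [← tprod_residue (fun n => 1 - q ^ n) (by omega : 1 ≤ h + 1) le_rfl,
    ← tprod_residue (fun n => 1 + q ^ n) (by omega : 1 ≤ h + 1) le_rfl,
    ← multipliable_one_sub_X_pow.tprod_mul (multipliable_factorOver _),
    ← (multipliable_one_sub_X_pow.mul (multipliable_factorOver _)).tprod_mul hp,
    ← multipliable_one_add_X_pow.tprod_mul hm]
  refine tprod_congr fun n => ?_
  have c0 : ((n + 1 : ℕ) : ℤ) ≡ 0 [ZMOD ((h + 1 : ℕ) : ℤ)] ↔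
      (n + 1) % (h + 1) = (h + 1) % (h + 1) := by
    rw [Nat.mod_self]
    exact Int.natCast_modEq_iff (b := 0)
  have hr := one_sub_X_pow_mul_recip n
  unfold factorOver
  simp only [c0]
  split_ifs with hc
  · ring
  · rw [mul_one, mul_one, mul_left_comm, hr, mul_one]

theorem multipliable_one_sub_X_pow_linear (M a : ℕ) :
    Multipliable fun k => 1 - q ^ ((M + 1) * k + a) :=
  multipliable_of_X_pow_dvd_sub_one fun k => X_pow_dvd_one_sub_X_pow_sub_one (by nlinarith)

theorem multipliable_one_add_X_pow_linear (M a : ℕ) :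
    Multipliable fun k => 1 + q ^ ((M + 1) * k + a) :=
  multipliable_of_X_pow_dvd_sub_one fun k => X_pow_dvd_one_add_X_pow_sub_one (by nlinarith)

/-- The multiples of `h + 1` are split into odd and even ones. -/
theorem tprod_X_pow_split (h : ℕ) :
    (∏' k, (1 - q ^ ((2 * h + 2) * k + (h + 1)))) *
      (∏' k, (1 - q ^ ((2 * h + 2) * k + (2 * h + 2)))) =
      ∏' k, (1 - q ^ ((h + 1) * k + (h + 1))) := by
  have he : ∀ k, 1 - q ^ ((h + 1) * (2 * k) + (h + 1)) =
      1 - q ^ ((2 * h + 2) * k + (h + 1)) := fun k => by ring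
  have ho : ∀ k, 1 - q ^ ((h + 1) * (2 * k + 1) + (h + 1)) =
      1 - q ^ ((2 * h + 2) * k + (2 * h + 2)) := fun k => by ring
  rw [← tprod_congr he, ← tprod_congr ho]
  exact tprod_even_mul_odd (f := fun k => 1 - q ^ ((h + 1) * k + (h + 1)))
    ((multipliable_one_sub_X_pow_linear (2 * h + 1) _).congr fun k => (he k).symm)
    ((multipliable_one_sub_X_pow_linear (2 * h + 1) _).congr fun k => (ho k).symm)

/-- Euler's identity between products over odd parts and over distinct parts, with base
`q ^ (h + 1)`. -/
theorem tprod_X_pow_euler (h : ℕ) :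
    (∏' k, (1 - q ^ ((2 * h + 2) * k + (h + 1)))) *
      (∏' k, (1 + q ^ ((h + 1) * k + (h + 1)))) = 1 := by
  have hpm : (∏' k, (1 - q ^ ((h + 1) * k + (h + 1)))) *
      (∏' k, (1 + q ^ ((h + 1) * k + (h + 1)))) =
      ∏' k, (1 - q ^ ((2 * h + 2) * k + (2 * h + 2))) := by
    rw [← (multipliable_one_sub_X_pow_linear _ _).tprod_mul
      (multipliable_one_add_X_pow_linear _ _)]
    exact tprod_congr fun k => by ring
  have hne : (∏' k, (1 - q ^ ((2 * h + 2) * k + (2 * h + 2)))) ≠ 0 := by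
    intro h0
    have hc := congrArg PowerSeries.constantCoeff h0
    rw [(multipliable_one_sub_X_pow_linear (2 * h + 1) _).map_tprod _
      (PowerSeries.WithPiTopology.continuous_constantCoeff ℤ)] at hc
    simp at hc
  apply mul_right_cancel₀ hne
  rw [one_mul, mul_right_comm, tprod_X_pow_split, hpm]

end Products

end JaggedPaths

theorem proposition7 (K κ ε i : ℕ) (hε : ε = 0 ∨ ε = 1) (hK : (K : ℤ) = 2 * (κ : ℤ) - (ε : ℤ))
    (hi : 1 ≤ i) (hiκ : i ≤ κ) :
    Summable (JaggedPaths.summandG K i 1) ∧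
    (2 * i < K + 1 →
      Multipliable (fun n : ℕ => 1 + JaggedPaths.q ^ (n + 1)) ∧
      Multipliable (fun n : ℕ => JaggedPaths.factorRR K i (n + 1)) ∧
      JaggedPaths.G K i 1 =
        (∏' n : ℕ, (1 + JaggedPaths.q ^ (n + 1))) *
          ∏' n : ℕ, JaggedPaths.factorRR K i (n + 1)) ∧
    (ε = 1 → i = κ →
      Multipliable (fun n : ℕ => JaggedPaths.factorOver κ (n + 1)) ∧
      JaggedPaths.G K i 1 = ∏' n : ℕ, JaggedPaths.factorOver κ (n + 1)) := by
  open JaggedPaths in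
  have hne : (∏' n, (1 - q ^ (n + 1))) ≠ 0 :=
    PowerSeries.WithPiTopology.tprod_one_sub_X_pow_ne_zero ℤ
  obtain ⟨h, rfl⟩ : ∃ h, i = h + 1 := ⟨i - 1, by omega⟩
  obtain ⟨t, rfl⟩ : ∃ t, K = 2 * h + t + 1 := ⟨K - (2 * h + 1), by omega⟩
  have hG := tprod_mul_G h t
  refine ⟨summable_summandG _ h, fun hlt => ⟨multipliable_one_add_X_pow,
    multipliable_factorRR _ _, ?_⟩, fun h1 h2 =>
    ⟨multipliable_factorOver κ, ?_⟩⟩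
  · apply mul_left_cancel₀ hne
    rw [hG, ← tprod_factorRR_mul (by omega)]
    ring
  -- For `t = 0` the two residue classes `± i` mod `K + 1 = 2 i` coincide.
  · obtain rfl : t = 0 := by omega
    subst h2
    have hO := tprod_factorOver_mul h
    have hS := tprod_X_pow_euler h
    simp only [add_zero] at hG ⊢
    set A := ∏' n, (1 - q ^ (n + 1))
    set B := ∏' n, (1 + q ^ (n + 1))
    set P := ∏' k, (1 + q ^ ((h + 1) * k + (h + 1)))
    set x := ∏' k, (1 - q ^ ((2 * h + 2) * k + (h + 1)))
    set Q := ∏' k, (1 - q ^ ((2 * h + 2) * k + (2 * h + 2)))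
    apply mul_left_cancel₀ hne
    calc A * G (2 * h + 1) (h + 1) 1 = B * (x * Q) * x := by rw [hG]; ring
      _ = A * (∏' n, factorOver (h + 1) (n + 1)) * (x * P) := by
        rw [tprod_X_pow_split, ← hO]; ring
      _ = _ := by rw [hS, mul_one]
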